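/- Let $X, Y$ be (real or complex) Hilbert spaces and let $T : X \to Y$ be an injective bounded linear operator with $\|T^*T\| < 1$. For $\alpha > 0$ let $$g_\alpha(\lambda) = \frac{1}{\lambda + (1-\lambda^{\sqrt{\alpha}})^2},$$ let $x^\dagger \in X$, $y = T x^\dagger$, and let $x_\alpha = g_\alpha(T^*T)\,T^* y$ be the regularized solution for exact data. For $p > 0$ put $f_p(\lambda) = (-\ln \lambda)^{-p}$ for $0 < \lambda < 1$ and $f_p(0) = 0$. The operators $g_\alpha(T^*T)$ and $f_p(T^*T)$ are defined by the functional calculus of the self-adjoint operator $T^*T$. Let $p > 0$. If $$\|x^\dagger - x_\alpha\| = \mathcal{O}\bigl(f_p(\alpha)\bigr) \quad \text{as } \alpha \downarrow 0,$$ then for every $q$ with $0 < q < p$ there is $\rho > 0$ such that $$x^\dagger \in X_{f_q}(\rho) = \{ f_q(T^*T) w : w \in X,\ \|w\| \le \rho \},$$ that is, $x^\dagger$ lies in the range of $(-\ln(T^*T))^{-q}$. -/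

import Mathlib

open Polynomial Set

/-- The real polynomial `p` evaluated at the bounded operator `A`. -/
noncomputable def polyOp {𝕜 X : Type*} [RCLike 𝕜] [NormedAddCommGroup X] [InnerProductSpace 𝕜 X]
    (p : ℝ[X]) (A : X →L[𝕜] X) : X →L[𝕜] X :=
  aeval A (p.map (algebraMap ℝ 𝕜))

/-- `B = f(A)` in the sense of the continuous functional calculus of a positive operator `A`
(whose spectrum lies in `[0, ‖A‖]`): there are polynomials `p` which are arbitrarily close to `f`
uniformly on `[0, ‖A‖]` while `p(A)` is arbitrarily close to `B` in operator norm. -/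
def IsFunctionOf {𝕜 X : Type*} [RCLike 𝕜] [NormedAddCommGroup X] [InnerProductSpace 𝕜 X]
    (f : ℝ → ℝ) (A B : X →L[𝕜] X) : Prop :=
  ∀ ε > (0 : ℝ), ∃ p : ℝ[X],
    (∀ t ∈ Icc (0 : ℝ) ‖A‖, |p.eval t - f t| ≤ ε) ∧ ‖polyOp p A - B‖ ≤ ε

open Classical in
/-- The operator `f(A)`, for a positive bounded operator `A` on a real or complex Hilbert space and
a function `f` that is continuous on `[0, ‖A‖]`. It exists and is unique for such `f` and `A`, see
`existsUnique_isFunctionOf` (and it is set to `0` when no such operator exists). -/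
noncomputable def funcCalc {𝕜 X : Type*} [RCLike 𝕜] [NormedAddCommGroup X] [InnerProductSpace 𝕜 X]
    (f : ℝ → ℝ) (A : X →L[𝕜] X) : X →L[𝕜] X :=
  if h : ∃ B, IsFunctionOf f A B then h.choose else 0

/-- The operator `T*T`. -/
noncomputable def normalOp {𝕜 X Y : Type*} [RCLike 𝕜]
    [NormedAddCommGroup X] [InnerProductSpace 𝕜 X] [CompleteSpace X]
    [NormedAddCommGroup Y] [InnerProductSpace 𝕜 Y] [CompleteSpace Y]
    (T : X →L[𝕜] Y) : X →L[𝕜] X :=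
  (ContinuousLinearMap.adjoint T).comp T

/-- The generator function `g_α(t) = 1 / (t + (1 - t ^ √α) ^ 2)` of the regularization method.
For `α > 0` it is continuous on `[0, ∞)`, with value `1` at `0`. -/
noncomputable def genFun (α t : ℝ) : ℝ :=
  1 / (t + (1 - t ^ √α) ^ 2)

/-- The logarithmic index function `f_p(t) = (-ln t) ^ (-p)`, `0 < t < 1`. For `p > 0` it extends
continuously by `f_p(0) = 0`, which is the value that Lean gives here (see `logFun_zero`). -/
noncomputable def logFun (p t : ℝ) : ℝ :=
  (-Real.log t) ^ (-p)

/-- The regularized solution `x_α = g_α(T*T) T* y`. -/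
noncomputable def regSol {𝕜 X Y : Type*} [RCLike 𝕜]
    [NormedAddCommGroup X] [InnerProductSpace 𝕜 X] [CompleteSpace X]
    [NormedAddCommGroup Y] [InnerProductSpace 𝕜 Y] [CompleteSpace Y]
    (T : X →L[𝕜] Y) (y : Y) (α : ℝ) : X :=
  funcCalc (genFun α) (normalOp T) (ContinuousLinearMap.adjoint T y)

/-- The source set `X_{f_p}(ρ) = {f_p(T*T) w : ‖w‖ ≤ ρ}` of the logarithmic source condition. -/
def logSourceSet {𝕜 X Y : Type*} [RCLike 𝕜]
    [NormedAddCommGroup X] [InnerProductSpace 𝕜 X] [CompleteSpace X]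
    [NormedAddCommGroup Y] [InnerProductSpace 𝕜 Y] [CompleteSpace Y]
    (T : X →L[𝕜] Y) (p ρ : ℝ) : Set X :=
  {x | ∃ w : X, ‖w‖ ≤ ρ ∧ x = funcCalc (logFun p) (normalOp T) w}

/-! The rest of this file checks that the operators `f(A)` used above are well defined. -/

section WellDefined

theorem polyOp_sub {𝕜 X : Type*} [RCLike 𝕜] [NormedAddCommGroup X] [InnerProductSpace 𝕜 X]
    (p q : ℝ[X]) (A : X →L[𝕜] X) : polyOp (p - q) A = polyOp p A - polyOp q A := by
  simp [polyOp]

theorem polyOp_mul {𝕜 X : Type*} [RCLike 𝕜] [NormedAddCommGroup X] [InnerProductSpace 𝕜 X]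
    (p q : ℝ[X]) (A : X →L[𝕜] X) : polyOp (p * q) A = polyOp p A * polyOp q A := by
  simp [polyOp]

theorem isSelfAdjoint_polyOp {𝕜 X : Type*} [RCLike 𝕜] [NormedAddCommGroup X]
    [InnerProductSpace 𝕜 X] [CompleteSpace X] (p : ℝ[X]) {A : X →L[𝕜] X} (hA : IsSelfAdjoint A) :
    IsSelfAdjoint (polyOp p A) := by
  induction p using Polynomial.induction_on' with
  | add p q hp hq =>
    have : polyOp (p + q) A = polyOp p A + polyOp q A := by simp [polyOp]
    rw [this]; exact hp.add hq
  | monomial n a =>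
    have : polyOp (monomial n a) A = (a : 𝕜) • A ^ n := by
      rw [← C_mul_X_pow_eq_monomial]
      simp [polyOp, Algebra.algebraMap_eq_smul_one]
    rw [this]
    refine IsSelfAdjoint.smul ?_ (hA.pow n)
    simp [IsSelfAdjoint]

theorem isUnit_of_coercive {𝕜 X : Type*} [RCLike 𝕜] [NormedAddCommGroup X]
    [InnerProductSpace 𝕜 X] [CompleteSpace X] (S : X →L[𝕜] X) {c : ℝ} (hc : 0 < c)
    (h : ∀ x, c * ‖x‖ ^ 2 ≤ |RCLike.re (inner 𝕜 (S x) x)|) : IsUnit S := by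
  refine ContinuousLinearMap.isUnit_of_forall_le_norm_inner_map S (c := ⟨c, hc.le⟩) hc fun x => ?_
  have := h x
  have h2 := RCLike.abs_re_le_norm (inner 𝕜 (S x) x)
  change ‖x‖ ^ 2 * c ≤ _
  linarith

/-- A polynomial without zeros in `[0, ‖A‖]` gives an invertible operator. -/
theorem isUnit_polyOp {𝕜 X : Type*} [RCLike 𝕜] [NormedAddCommGroup X]
    [InnerProductSpace 𝕜 X] [CompleteSpace X] {A : X →L[𝕜] X} (hA : A.IsPositive) (q : ℝ[X])
    (hq : ∀ t ∈ Icc (0 : ℝ) ‖A‖, q.eval t ≠ 0) : IsUnit (polyOp q A) := by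
  induction q using WfDvdMonoid.induction_on_irreducible with
  | zero => exact absurd (by simp) (hq 0 ⟨le_rfl, norm_nonneg _⟩)
  | unit u hu =>
    have := hu.map ((aeval A).toRingHom.comp (Polynomial.mapRingHom (algebraMap ℝ 𝕜)))
    simpa [polyOp] using this
  | mul a i ha hi ih =>
    rw [polyOp_mul]
    refine IsUnit.mul ?_ (ih fun t ht h0 => hq t ht (by simp [h0]))
    have hi0 : ∀ t ∈ Icc (0 : ℝ) ‖A‖, i.eval t ≠ 0 := fun t ht h0 => hq t ht (by simp [h0])
    obtain ⟨c2, c1, c0, rfl⟩ : ∃ c2 c1 c0 : ℝ,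
        i = C c2 * Polynomial.X ^ 2 + C c1 * Polynomial.X + C c0 :=
      ⟨_, _, _, Polynomial.eq_quadratic_of_degree_le_two hi.degree_le_two⟩
    have hev : ∀ t : ℝ, (C c2 * Polynomial.X ^ 2 + C c1 * Polynomial.X + C c0 : ℝ[X]).eval t
        = c2 * t ^ 2 + c1 * t + c0 := fun t => by simp
    simp only [hev] at hi0
    have hop : ∀ x, RCLike.re (inner 𝕜 (polyOp (C c2 * Polynomial.X ^ 2 + C c1 * Polynomial.X
        + C c0 : ℝ[X]) A x) x) = c2 * ‖A x‖ ^ 2 + c1 * RCLike.re (inner 𝕜 (A x) x)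
        + c0 * ‖x‖ ^ 2 := by
      intro x
      have h1 : polyOp (C c2 * Polynomial.X ^ 2 + C c1 * Polynomial.X + C c0 : ℝ[X]) A x
          = (c2 : 𝕜) • A (A x) + (c1 : 𝕜) • A x + (c0 : 𝕜) • x := by
        simp [polyOp, Algebra.algebraMap_eq_smul_one, pow_two]
      rw [h1, inner_add_left, inner_add_left, inner_smul_left, inner_smul_left, inner_smul_left,
        hA.inner_left_eq_inner_right (A x) x]
      simp only [RCLike.conj_ofReal, map_add, RCLike.re_ofReal_mul, inner_self_eq_norm_sq]
    have hb0 : ∀ x, 0 ≤ RCLike.re (inner 𝕜 (A x) x) := hA.re_inner_nonneg_left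
    have hbn : ∀ x, RCLike.re (inner 𝕜 (A x) x) ≤ ‖A x‖ * ‖x‖ := fun x => re_inner_le_norm _ _
    have hM : ∀ x, RCLike.re (inner 𝕜 (A x) x) ≤ ‖A‖ * ‖x‖ ^ 2 := fun x => by
      have h1 := mul_le_mul_of_nonneg_right (A.le_opNorm x) (norm_nonneg x)
      linarith [hbn x]
    by_cases h2 : c2 = 0
    · subst h2
      by_cases h1 : c1 = 0
      · subst h1
        have h0 : c0 ≠ 0 := by simpa using hi0 0 ⟨le_rfl, norm_nonneg _⟩
        refine isUnit_of_coercive _ (abs_pos.2 h0) fun x => ?_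
        rw [hop]
        simp [abs_mul]
      · have hr : ∀ t, 0 * t ^ 2 + c1 * t + c0 = c1 * (t - -c0 / c1) := fun t => by
          field_simp; ring
        have hr' : -c0 / c1 < 0 ∨ ‖A‖ < -c0 / c1 := by
          by_contra! hcon
          exact hi0 _ hcon (by rw [hr]; ring)
        have hop' : ∀ x, |0 * ‖A x‖ ^ 2 + c1 * RCLike.re (inner 𝕜 (A x) x) + c0 * ‖x‖ ^ 2|
            = |c1| * |RCLike.re (inner 𝕜 (A x) x) - -c0 / c1 * ‖x‖ ^ 2| := fun x => by
          rw [← abs_mul]; congr 1; field_simp; ring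
        have hc1 := abs_pos.2 h1
        generalize -c0 / c1 = r at hr' hop'
        rcases hr' with h | h
        · refine isUnit_of_coercive _ (mul_pos hc1 (neg_pos.2 h)) fun x => ?_
          rw [hop, hop', mul_assoc]
          refine mul_le_mul_of_nonneg_left (le_trans ?_ (le_abs_self _)) hc1.le
          linarith [hb0 x]
        · refine isUnit_of_coercive _ (mul_pos hc1 (sub_pos.2 h)) fun x => ?_
          rw [hop, hop', mul_assoc]
          refine mul_le_mul_of_nonneg_left (le_trans ?_ (neg_le_abs _)) hc1.le
          linarith [hM x]
    · have hdisc : c1 ^ 2 < 4 * c2 * c0 := by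
        by_contra! hcon
        obtain ⟨t, ht⟩ := exists_quadratic_eq_zero (a := c2) (b := c1) (c := c0) h2
          ⟨√(discrim c2 c1 c0), (Real.mul_self_sqrt (by unfold discrim; linarith)).symm⟩
        have h1 := degree_eq_one_of_irreducible_of_root hi (x := t)
          (by rw [IsRoot, hev, ← ht]; ring)
        rw [degree_quadratic h2] at h1
        exact absurd h1 (by norm_num)
      have h4 : 0 < 4 * |c2| := by have := abs_pos.2 h2; linarith
      refine isUnit_of_coercive _ (div_pos (sub_pos.2 hdisc) h4) fun x => ?_
      rw [hop, div_mul_eq_mul_div, div_le_iff₀ h4,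
        show (4 : ℝ) * |c2| = |4 * c2| by rw [abs_mul]; norm_num, ← abs_mul]
      refine le_trans ?_ (le_abs_self _)
      have h5 : 0 ≤ (2 * |c2| * ‖A x‖ - |c1| * ‖x‖) ^ 2 := sq_nonneg _
      have h6 : -(|c2| * |c1| * (‖A x‖ * ‖x‖)) ≤ c2 * c1 * RCLike.re (inner 𝕜 (A x) x) := by
        have h7 : |c2 * c1 * RCLike.re (inner 𝕜 (A x) x)| ≤ |c2| * |c1| * (‖A x‖ * ‖x‖) := by
          rw [abs_mul, abs_mul, abs_of_nonneg (hb0 x)]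
          exact mul_le_mul_of_nonneg_left (hbn x) (by positivity)
        linarith [neg_abs_le (c2 * c1 * RCLike.re (inner 𝕜 (A x) x))]
      have h8 := sq_abs c2
      have h9 := sq_abs c1
      have h10 : (2 * |c2| * ‖A x‖ - |c1| * ‖x‖) ^ 2 = 4 * c2 ^ 2 * ‖A x‖ ^ 2
          - 4 * (|c2| * |c1| * (‖A x‖ * ‖x‖)) + c1 ^ 2 * ‖x‖ ^ 2 := by
        rw [← h8, ← h9]; ring
      nlinarith

theorem norm_polyOp_le {𝕜 X : Type*} [RCLike 𝕜] [NormedAddCommGroup X]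
    [InnerProductSpace 𝕜 X] [CompleteSpace X] {A : X →L[𝕜] X} (hA : A.IsPositive) (p : ℝ[X])
    {s : ℝ} (hs : ∀ t ∈ Icc (0 : ℝ) ‖A‖, |p.eval t| ≤ s) : ‖polyOp p A‖ ≤ s := by
  have hs0 : 0 ≤ s := (abs_nonneg _).trans (hs 0 ⟨le_rfl, norm_nonneg _⟩)
  by_contra! hlt
  rcases subsingleton_or_nontrivial X with hX | hX
  · have : polyOp p A = 0 := Subsingleton.elim _ _
    rw [this, norm_zero] at hlt
    linarith
  have hS := isSelfAdjoint_polyOp p hA.isSelfAdjoint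
  have key : ∀ c : ℝ, s < |c| → IsUnit (polyOp p A - algebraMap 𝕜 (X →L[𝕜] X) (c : 𝕜)) := by
    intro c hc
    have : polyOp p A - algebraMap 𝕜 (X →L[𝕜] X) (c : 𝕜) = polyOp (p - C c) A := by
      simp [polyOp]
    rw [this]
    refine isUnit_polyOp hA _ fun t ht h0 => ?_
    have := hs t ht
    rw [eval_sub, eval_C, sub_eq_zero] at h0
    rw [h0] at this
    linarith
  have h1 : algebraMap ℝ 𝕜 ‖polyOp p A‖ ∈ resolventSet 𝕜 (polyOp p A) := by
    have := (key ‖polyOp p A‖ (by rwa [abs_norm])).neg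
    rw [neg_sub] at this
    exact this
  have h2 : -algebraMap ℝ 𝕜 ‖polyOp p A‖ ∈ resolventSet 𝕜 (polyOp p A) := by
    have := (key (-‖polyOp p A‖) (by rwa [abs_neg, abs_norm])).neg
    rw [neg_sub] at this
    simpa [spectrum.mem_resolventSet_iff] using this
  obtain ⟨c, hc0, hc⟩ :=
    ContinuousLinearMap.abs_rayleighQuotient_le_of_norm_mem_resolventSet _ h1 h2
  have h3 := ContinuousLinearMap.norm_eq_iSup_rayleighQuotient (polyOp p A) hS.isSymmetric
  have h4 := ciSup_le hc
  linarith

theorem existsUnique_isFunctionOf {𝕜 X : Type*} [RCLike 𝕜] [NormedAddCommGroup X]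
    [InnerProductSpace 𝕜 X] [CompleteSpace X] {A : X →L[𝕜] X} (hA : A.IsPositive) {f : ℝ → ℝ}
    (hf : ContinuousOn f (Icc 0 ‖A‖)) : ∃! B, IsFunctionOf f A B := by
  have hdist : ∀ (p q : ℝ[X]) (a b : ℝ), (∀ t ∈ Icc (0 : ℝ) ‖A‖, |p.eval t - f t| ≤ a) →
      (∀ t ∈ Icc (0 : ℝ) ‖A‖, |q.eval t - f t| ≤ b) → ‖polyOp p A - polyOp q A‖ ≤ a + b := by
    intro p q a b hp hq
    rw [← polyOp_sub]
    refine norm_polyOp_le hA _ fun t ht => ?_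
    rw [eval_sub]
    have h1 := abs_le.1 (hp t ht)
    have h2 := abs_le.1 (hq t ht)
    exact abs_le.2 ⟨by linarith, by linarith⟩
  have hpos : ∀ n : ℕ, (0 : ℝ) < 1 / ((n : ℝ) + 1) := fun n => by positivity
  choose P hP using fun n : ℕ =>
    exists_polynomial_near_of_continuousOn 0 ‖A‖ f hf (1 / ((n : ℝ) + 1)) (hpos n)
  have hlim := tendsto_one_div_add_atTop_nhds_zero_nat (𝕜 := ℝ)
  have hC : CauchySeq fun n => polyOp (P n) A := by
    refine cauchySeq_of_le_tendsto_0' (fun n : ℕ => 2 * (1 / ((n : ℝ) + 1))) (fun n m hnm => ?_)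
      (by simpa using hlim.const_mul 2)
    rw [dist_eq_norm]
    have := hdist (P n) (P m) _ _ (fun t ht => (hP n t ht).le) (fun t ht => (hP m t ht).le)
    have h2 : 1 / ((m : ℝ) + 1) ≤ 1 / ((n : ℝ) + 1) := by gcongr
    linarith
  obtain ⟨B, hB⟩ := cauchySeq_tendsto_of_complete hC
  refine ⟨B, fun ε hε => ?_, fun B' hB' => ?_⟩
  · have h1 := (Metric.tendsto_nhds.1 hB ε hε).and (hlim.eventually (gt_mem_nhds hε))
    obtain ⟨n, hn1, hn2⟩ := h1.exists
    exact ⟨P n, fun t ht => ((hP n t ht).trans hn2).le, by rw [← dist_eq_norm]; exact hn1.le⟩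
  · rw [← sub_eq_zero, ← norm_le_zero_iff]
    refine le_of_forall_pos_le_add fun ε hε => ?_
    have h1 := (Metric.tendsto_nhds.1 hB (ε / 4) (by positivity)).and
      (hlim.eventually (gt_mem_nhds (show 0 < ε / 4 by positivity)))
    obtain ⟨n, hn1, hn2⟩ := h1.exists
    obtain ⟨p, hp1, hp2⟩ := hB' (ε / 4) (by positivity)
    have h3 := hdist p (P n) _ _ hp1 (fun t ht => ((hP n t ht).trans hn2).le)
    rw [dist_eq_norm] at hn1
    have h4 : B' - B = -(polyOp p A - B') + (polyOp p A - polyOp (P n) A)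
      + (polyOp (P n) A - B) := by abel
    rw [h4]
    have h5 := norm_add₃_le (a := -(polyOp p A - B')) (b := polyOp p A - polyOp (P n) A)
      (c := polyOp (P n) A - B)
    rw [norm_neg] at h5
    linarith

theorem isFunctionOf_funcCalc {𝕜 X : Type*} [RCLike 𝕜] [NormedAddCommGroup X]
    [InnerProductSpace 𝕜 X] [CompleteSpace X] {A : X →L[𝕜] X} (hA : A.IsPositive) {f : ℝ → ℝ}
    (hf : ContinuousOn f (Icc 0 ‖A‖)) : IsFunctionOf f A (funcCalc f A) := by
  have h := (existsUnique_isFunctionOf hA hf).exists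
  rw [funcCalc, dif_pos h]
  exact h.choose_spec

theorem isPositive_normalOp {𝕜 X Y : Type*} [RCLike 𝕜]
    [NormedAddCommGroup X] [InnerProductSpace 𝕜 X] [CompleteSpace X]
    [NormedAddCommGroup Y] [InnerProductSpace 𝕜 Y] [CompleteSpace Y]
    (T : X →L[𝕜] Y) : (normalOp T).IsPositive :=
  ContinuousLinearMap.isPositive_adjoint_comp_self T

theorem logFun_zero {p : ℝ} (hp : p ≠ 0) : logFun p 0 = 0 := by
  simp [logFun, Real.zero_rpow (neg_ne_zero.2 hp)]

theorem continuousOn_genFun {α : ℝ} (hα : 0 < α) : ContinuousOn (genFun α) (Ici 0) := by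
  have h0 : 0 < √α := Real.sqrt_pos.2 hα
  refine ContinuousOn.div continuousOn_const (Continuous.continuousOn ?_) fun t ht => ?_
  · have := Real.continuous_rpow_const h0.le
    fun_prop
  · rcases (mem_Ici.1 ht).eq_or_lt with h | h
    · simp [← h, Real.zero_rpow h0.ne']
    · positivity

theorem continuousOn_logFun {p : ℝ} (hp : 0 < p) : ContinuousOn (logFun p) (Ico 0 1) := by
  intro t ht
  rcases ht.1.eq_or_lt with h | h
  · subst h
    rw [ContinuousWithinAt, logFun_zero hp.ne']
    have h1 : Filter.Tendsto (logFun p) (nhdsWithin 0 (Ioi 0)) (nhds 0) :=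
      (tendsto_rpow_neg_atTop hp).comp
        (Filter.tendsto_neg_atBot_atTop.comp Real.tendsto_log_nhdsGT_zero)
    have h2 : Filter.Tendsto (logFun p) (nhdsWithin 0 (insert 0 (Ioi 0))) (nhds 0) := by
      rw [nhdsWithin_insert, Filter.tendsto_sup]
      refine ⟨?_, h1⟩
      have := tendsto_pure_nhds (logFun p) (0 : ℝ)
      rwa [logFun_zero hp.ne'] at this
    refine h2.mono_left (nhdsWithin_mono _ fun s hs => ?_)
    rcases hs.1.eq_or_lt with h | h
    · exact Or.inl h.symm
    · exact Or.inr h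
  · refine ContinuousAt.continuousWithinAt ?_
    refine ((Real.continuousAt_log h.ne').neg).rpow_const (Or.inl ?_)
    exact (neg_pos.2 (Real.log_neg h ht.2)).ne'

end WellDefined

/-!
Write `A = T*T`, so that `x† - x_α = r_α(A) x†` with the residual function
`r_α(t) = 1 - t g_α(t) = (1 - t^√α)² / (t + (1 - t^√α)²)`.

The residual function is positive on `[0, 1)` and, for `α ≤ 1/e`, at least `1/5` on `[0, α]`
(`one_fifth_le_resFun`). Hence a continuous function `f` that vanishes on `(α, ‖A‖]` and is bounded
by `K` satisfies `|f| ≤ 5 K r_α`, and so `‖f(A) x‖ ≤ 5 K ‖r_α(A) x‖`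
(`norm_funcCalc_apply_le_resFun`): the rate controls the part of `x†` that lives on the spectrum
below `α`. No spectral measure is needed for this, only the quotient `f / r_α` in the continuous
functional calculus.

Let `h_N(t) = min(-ln t, N)^q` be the truncation at height `N` of the unbounded function `1 / f_q`.
Both `h_M - h_N` (for `N ≤ M`) and `1 - f_q h_N` vanish for `t > e^{-N}`, and they are bounded by
`M^q` and `1`. With `N = 2^n`, `M = 2^{n+1}` and `α = e^{-2^n}`, for which `f_p(α) = 2^{-np}`, the
vectors `w_n = h_{2^n}(A) x†` satisfy `‖w_{n+1} - w_n‖ = O(2^{-n(p-q)})` and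
`‖x† - f_q(A) w_n‖ = O(2^{-np})`. So `w_n` converges to some `w`, and `f_q(A) w = x†`.
-/

/-! ### The functional calculus -/

section FunctionalCalculus

variable {𝕜 X : Type*} [RCLike 𝕜] [NormedAddCommGroup X] [InnerProductSpace 𝕜 X]

theorem isFunctionOf_eval (p : ℝ[X]) (A : X →L[𝕜] X) :
    IsFunctionOf (fun t => p.eval t) A (polyOp p A) := fun ε hε =>
  ⟨p, fun t _ => by simpa using hε.le, by simpa using hε.le⟩

theorem IsFunctionOf.sub {f g : ℝ → ℝ} {A B C : X →L[𝕜] X} (hf : IsFunctionOf f A B)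
    (hg : IsFunctionOf g A C) : IsFunctionOf (fun t => f t - g t) A (B - C) := by
  intro ε hε
  obtain ⟨p, hp, hpB⟩ := hf (ε / 2) (by positivity)
  obtain ⟨r, hr, hrC⟩ := hg (ε / 2) (by positivity)
  refine ⟨p - r, fun t ht => ?_, ?_⟩
  · have h1 := abs_le.1 (hp t ht)
    have h2 := abs_le.1 (hr t ht)
    rw [eval_sub]
    exact abs_le.2 ⟨by linarith, by linarith⟩
  · rw [polyOp_sub, sub_sub_sub_comm]
    exact (norm_sub_le _ _).trans (by linarith)

theorem norm_mul_sub_mul_le {R : Type*} [NormedRing R] {P F Q G : R} {δ M : ℝ} (hδ0 : 0 ≤ δ)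
    (hδ1 : δ ≤ 1) (hP : ‖P - F‖ ≤ δ) (hQ : ‖Q - G‖ ≤ δ) (hF : ‖F‖ ≤ M) (hG : ‖G‖ ≤ M) :
    ‖P * Q - F * G‖ ≤ δ * (2 * M + 1) := by
  have h1 : P * Q - F * G = (P - F) * (Q - G) + (P - F) * G + F * (Q - G) := by noncomm_ring
  rw [h1]
  have h2 : ‖(P - F) * (Q - G)‖ ≤ δ * δ := norm_mul_le_of_le hP hQ
  have h3 : ‖(P - F) * G‖ ≤ δ * M := norm_mul_le_of_le hP hG
  have h4 : ‖F * (Q - G)‖ ≤ M * δ := norm_mul_le_of_le hF hQ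
  have h5 := norm_add₃_le (a := (P - F) * (Q - G)) (b := (P - F) * G) (c := F * (Q - G))
  have h6 : δ * δ ≤ δ := mul_le_of_le_one_left hδ0 hδ1
  linarith

theorem IsFunctionOf.mul {f g : ℝ → ℝ} {A B C : X →L[𝕜] X} (hf : IsFunctionOf f A B)
    (hg : IsFunctionOf g A C) (hfc : ContinuousOn f (Icc 0 ‖A‖))
    (hgc : ContinuousOn g (Icc 0 ‖A‖)) : IsFunctionOf (fun t => f t * g t) A (B * C) := by
  obtain ⟨a, ha⟩ := isCompact_Icc.exists_bound_of_continuousOn hfc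
  obtain ⟨b, hb⟩ := isCompact_Icc.exists_bound_of_continuousOn hgc
  -- `M` bounds the two functions and the two operators, so that one estimate serves both
  obtain ⟨M, hM0, haM, hbM, hBM, hCM⟩ : ∃ M : ℝ, 0 ≤ M ∧ a ≤ M ∧ b ≤ M ∧ ‖B‖ ≤ M ∧ ‖C‖ ≤ M :=
    ⟨max (max a b) (max ‖B‖ ‖C‖), by simp, by simp, by simp, by simp, by simp⟩
  intro ε hε
  obtain ⟨δ, hδ0, hδ1, hδ⟩ : ∃ δ : ℝ, 0 < δ ∧ δ ≤ 1 ∧ δ * (2 * M + 1) ≤ ε := by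
    refine ⟨min 1 (ε / (2 * M + 1)), by positivity, min_le_left _ _, ?_⟩
    rw [← le_div_iff₀ (by positivity)]
    exact min_le_right _ _
  obtain ⟨p, hp, hpB⟩ := hf δ hδ0
  obtain ⟨r, hr, hrC⟩ := hg δ hδ0
  refine ⟨p * r, fun t ht => ?_, ?_⟩
  · rw [eval_mul]
    exact (norm_mul_sub_mul_le hδ0.le hδ1 (hp t ht) (hr t ht) ((ha t ht).trans haM)
      ((hb t ht).trans hbM)).trans hδ
  · rw [polyOp_mul]
    exact (norm_mul_sub_mul_le hδ0.le hδ1 hpB hrC hBM hCM).trans hδ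

variable [CompleteSpace X] {A : X →L[𝕜] X} {f g : ℝ → ℝ}

theorem IsFunctionOf.funcCalc_eq (hA : A.IsPositive) (hf : ContinuousOn f (Icc 0 ‖A‖))
    {B : X →L[𝕜] X} (hB : IsFunctionOf f A B) : funcCalc f A = B :=
  (existsUnique_isFunctionOf hA hf).unique (isFunctionOf_funcCalc hA hf) hB

theorem funcCalc_one (hA : A.IsPositive) : funcCalc (fun _ => 1) A = 1 :=
  IsFunctionOf.funcCalc_eq hA continuousOn_const
    (by simpa [polyOp] using isFunctionOf_eval (1 : ℝ[X]) A)

theorem funcCalc_id (hA : A.IsPositive) : funcCalc (fun t => t) A = A :=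
  IsFunctionOf.funcCalc_eq hA (continuousOn_id' _)
    (by simpa [polyOp] using isFunctionOf_eval (Polynomial.X : ℝ[X]) A)

theorem funcCalc_sub (hA : A.IsPositive) (hf : ContinuousOn f (Icc 0 ‖A‖))
    (hg : ContinuousOn g (Icc 0 ‖A‖)) :
    funcCalc (fun t => f t - g t) A = funcCalc f A - funcCalc g A :=
  ((isFunctionOf_funcCalc hA hf).sub (isFunctionOf_funcCalc hA hg)).funcCalc_eq hA (hf.sub hg)

theorem funcCalc_mul (hA : A.IsPositive) (hf : ContinuousOn f (Icc 0 ‖A‖))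
    (hg : ContinuousOn g (Icc 0 ‖A‖)) :
    funcCalc (fun t => f t * g t) A = funcCalc f A * funcCalc g A :=
  ((isFunctionOf_funcCalc hA hf).mul (isFunctionOf_funcCalc hA hg) hf hg).funcCalc_eq hA
    (hf.mul hg)

theorem funcCalc_congr (hA : A.IsPositive) (hg : ContinuousOn g (Icc 0 ‖A‖))
    (hfg : EqOn f g (Icc 0 ‖A‖)) : funcCalc f A = funcCalc g A := by
  refine IsFunctionOf.funcCalc_eq hA (hg.congr hfg) fun ε hε => ?_
  obtain ⟨p, hp, hpA⟩ := isFunctionOf_funcCalc hA hg ε hε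
  exact ⟨p, fun t ht => by rw [hfg ht]; exact hp t ht, hpA⟩

theorem norm_funcCalc_le (hA : A.IsPositive) (hf : ContinuousOn f (Icc 0 ‖A‖)) {s : ℝ}
    (hs : ∀ t ∈ Icc (0 : ℝ) ‖A‖, |f t| ≤ s) : ‖funcCalc f A‖ ≤ s := by
  refine le_of_forall_pos_le_add fun ε hε => ?_
  obtain ⟨p, hp, hpA⟩ := isFunctionOf_funcCalc hA hf (ε / 2) (by positivity)
  have h1 : ‖polyOp p A‖ ≤ s + ε / 2 := norm_polyOp_le hA p fun t ht => by
    have := abs_sub_abs_le_abs_sub (p.eval t) (f t)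
    linarith [hp t ht, hs t ht]
  have h2 := norm_sub_norm_le (funcCalc f A) (polyOp p A)
  rw [norm_sub_rev] at h2
  linarith

/-- Pointwise domination of functions carries over to the operators. Positivity of `g` makes the
quotient `f / g` continuous, and `f(A) = (f / g)(A) g(A)`. -/
theorem norm_funcCalc_apply_le (hA : A.IsPositive) (hf : ContinuousOn f (Icc 0 ‖A‖))
    (hg : ContinuousOn g (Icc 0 ‖A‖)) (hg0 : ∀ t ∈ Icc (0 : ℝ) ‖A‖, 0 < g t) {c : ℝ}
    (hfg : ∀ t ∈ Icc (0 : ℝ) ‖A‖, |f t| ≤ c * g t) (x : X) :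
    ‖funcCalc f A x‖ ≤ c * ‖funcCalc g A x‖ := by
  have hq : ContinuousOn (fun t => f t / g t) (Icc 0 ‖A‖) :=
    hf.div hg fun t ht => (hg0 t ht).ne'
  have h1 : funcCalc f A = funcCalc (fun t => f t / g t) A * funcCalc g A := by
    rw [← funcCalc_mul hA hq hg]
    exact funcCalc_congr hA (hq.mul hg) fun t ht => (div_mul_cancel₀ _ (hg0 t ht).ne').symm
  rw [h1]
  refine ContinuousLinearMap.le_of_opNorm_le _ (norm_funcCalc_le hA hq fun t ht => ?_) _
  rw [abs_div, abs_of_pos (hg0 t ht), div_le_iff₀ (hg0 t ht)]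
  exact hfg t ht

end FunctionalCalculus

/-! ### The residual function -/

/-- The residual function `r_α(t) = 1 - t g_α(t)`, for which `x† - x_α = r_α(T*T) x†`. -/
noncomputable def resFun (α t : ℝ) : ℝ :=
  1 - t * genFun α t

theorem continuousOn_resFun {α : ℝ} (hα : 0 < α) : ContinuousOn (resFun α) (Ici 0) :=
  continuousOn_const.sub (continuousOn_id.mul (continuousOn_genFun hα))

theorem resFun_eq {α t : ℝ} (hα : 0 < α) (ht : t ∈ Ico (0 : ℝ) 1) :
    0 < 1 - t ^ √α ∧ resFun α t = (1 - t ^ √α) ^ 2 / (t + (1 - t ^ √α) ^ 2) := by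
  have h1 : 0 < 1 - t ^ √α := sub_pos.2 (Real.rpow_lt_one ht.1 ht.2 (Real.sqrt_pos.2 hα))
  have h2 : 0 < t + (1 - t ^ √α) ^ 2 := add_pos_of_nonneg_of_pos ht.1 (by positivity)
  refine ⟨h1, ?_⟩
  rw [resFun, genFun]
  field_simp
  ring

theorem resFun_pos {α t : ℝ} (hα : 0 < α) (ht : t ∈ Ico (0 : ℝ) 1) : 0 < resFun α t := by
  obtain ⟨h1, h2⟩ := resFun_eq hα ht
  have := ht.1
  rw [h2]
  positivity

theorem one_fifth_le_resFun {α t : ℝ} (hα : 0 < α) (hα1 : α ≤ Real.exp (-1)) (ht0 : 0 ≤ t)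
    (htα : t ≤ α) : 1 / 5 ≤ resFun α t := by
  have hα2 : α < 1 := hα1.trans_lt (by simp)
  obtain ⟨h1, h2⟩ := resFun_eq hα ⟨ht0, htα.trans_lt hα2⟩
  have hs0 : 0 < √α := Real.sqrt_pos.2 hα
  have hs1 : √α ≤ 1 := Real.sqrt_le_one.2 hα2.le
  -- `t ^ √α ≤ α ^ √α ≤ e ^ (-√α) ≤ 1 / (1 + √α)`
  have h3 : t ^ √α * (1 + √α) ≤ 1 := by
    have h4 : t ^ √α ≤ Real.exp (-√α) := by
      refine (Real.rpow_le_rpow ht0 (htα.trans hα1) hs0.le).trans_eq ?_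
      rw [← Real.exp_mul, neg_one_mul]
    have h5 : 1 + √α ≤ Real.exp √α := by linarith [Real.add_one_le_exp √α]
    calc t ^ √α * (1 + √α) ≤ Real.exp (-√α) * Real.exp √α := by gcongr
      _ = 1 := by rw [← Real.exp_add, neg_add_cancel, Real.exp_zero]
  have h4 : √α / 2 ≤ 1 - t ^ √α := by nlinarith [Real.rpow_nonneg ht0 √α]
  have h5 : α ≤ 4 * (1 - t ^ √α) ^ 2 := by
    have h6 := Real.sq_sqrt hα.le
    nlinarith
  rw [h2, le_div_iff₀ (add_pos_of_nonneg_of_pos ht0 (by positivity))]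
  linarith

theorem sub_regSol_eq {𝕜 X Y : Type*} [RCLike 𝕜]
    [NormedAddCommGroup X] [InnerProductSpace 𝕜 X] [CompleteSpace X]
    [NormedAddCommGroup Y] [InnerProductSpace 𝕜 Y] [CompleteSpace Y]
    (T : X →L[𝕜] Y) (x : X) {α : ℝ} (hα : 0 < α) :
    x - regSol T (T x) α = funcCalc (resFun α) (normalOp T) x := by
  have hA := isPositive_normalOp T
  have hg : ContinuousOn (genFun α) (Icc 0 ‖normalOp T‖) :=
    (continuousOn_genFun hα).mono Icc_subset_Ici_self
  have h1 : funcCalc (resFun α) (normalOp T)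
      = 1 - funcCalc (genFun α) (normalOp T) * normalOp T := by
    have h2 : resFun α = fun t => 1 - genFun α t * t := by
      funext t
      rw [resFun, mul_comm]
    rw [h2, funcCalc_sub hA continuousOn_const (hg.fun_mul (continuousOn_id' _)), funcCalc_one hA,
      funcCalc_mul hA hg (continuousOn_id' _), funcCalc_id hA]
  rw [h1]
  simp [regSol, normalOp]

/-- The residual at level `α` dominates `f(A) x` for every `f` supported in `[0, α]`. -/
theorem norm_funcCalc_apply_le_resFun {𝕜 X : Type*} [RCLike 𝕜] [NormedAddCommGroup X]
    [InnerProductSpace 𝕜 X] [CompleteSpace X] {A : X →L[𝕜] X} (hA : A.IsPositive)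
    (hA1 : ‖A‖ < 1) {α : ℝ} (hα : 0 < α) (hα1 : α ≤ Real.exp (-1)) {f : ℝ → ℝ}
    (hf : ContinuousOn f (Icc 0 ‖A‖)) {K : ℝ}
    (hK : ∀ t ∈ Icc (0 : ℝ) ‖A‖, |f t| ≤ K)
    (hf0 : ∀ t ∈ Icc (0 : ℝ) ‖A‖, α < t → f t = 0) (x : X) :
    ‖funcCalc f A x‖ ≤ 5 * K * ‖funcCalc (resFun α) A x‖ := by
  have hpos : ∀ t ∈ Icc (0 : ℝ) ‖A‖, 0 < resFun α t := fun t ht =>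
    resFun_pos hα ⟨ht.1, ht.2.trans_lt hA1⟩
  refine norm_funcCalc_apply_le hA hf ((continuousOn_resFun hα).mono Icc_subset_Ici_self) hpos
    (fun t ht => ?_) x
  have hK0 : 0 ≤ K := (abs_nonneg _).trans (hK t ht)
  rcases le_or_gt t α with h | h
  · have := one_fifth_le_resFun hα hα1 ht.1 h
    have := hK t ht
    nlinarith
  · rw [hf0 t ht h, abs_zero]
    have := hpos t ht
    positivity

/-! ### Truncations of the reciprocal of a logarithmic index function -/

/-- The truncation `min(-ln t, N) ^ q` of `(-ln t) ^ q`, for `0 < t < 1`. It is written in terms of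
`(-ln t)⁻¹ = logFun 1 t`, whose value `0` at `t = 0` makes the truncation continuous there, with
value `N ^ q`. -/
noncomputable def truncLog (q N t : ℝ) : ℝ :=
  (max (logFun 1 t) N⁻¹) ^ (-q)

theorem logFun_one_nonneg {t : ℝ} (ht : t ∈ Ico (0 : ℝ) 1) : 0 ≤ logFun 1 t :=
  Real.rpow_nonneg (neg_nonneg.2 (Real.log_nonpos ht.1 ht.2.le)) _

theorem logFun_eq_rpow {q t : ℝ} (ht : t ∈ Ico (0 : ℝ) 1) : logFun q t = logFun 1 t ^ q := by
  rw [logFun, logFun, ← Real.rpow_mul (neg_nonneg.2 (Real.log_nonpos ht.1 ht.2.le)),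
    neg_one_mul]

theorem continuousOn_truncLog {q N : ℝ} (hN : 0 < N) :
    ContinuousOn (truncLog q N) (Ico 0 1) := by
  refine ((continuousOn_logFun one_pos).sup continuousOn_const).rpow_const fun t _ => Or.inl ?_
  exact (lt_max_of_lt_right (inv_pos.2 hN)).ne'

theorem truncLog_nonneg {q N t : ℝ} (hN : 0 < N) : 0 ≤ truncLog q N t :=
  Real.rpow_nonneg (le_max_of_le_right (inv_pos.2 hN).le) _

theorem truncLog_le {q N t : ℝ} (hq : 0 < q) (hN : 0 < N) : truncLog q N t ≤ N ^ q := by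
  refine (Real.rpow_le_rpow_of_nonpos (inv_pos.2 hN) (le_max_right _ _)
    (neg_nonpos.2 hq.le)).trans_eq ?_
  rw [Real.inv_rpow hN.le, Real.rpow_neg hN.le, inv_inv]

theorem inv_le_logFun_one {N t : ℝ} (ht1 : t < 1) (ht : Real.exp (-N) < t) :
    N⁻¹ ≤ logFun 1 t := by
  have ht0 : 0 < t := (Real.exp_pos _).trans ht
  have h1 : -Real.log t < N := by
    have := (Real.lt_log_iff_exp_lt ht0).2 ht
    linarith
  rw [logFun, Real.rpow_neg_one]
  exact inv_anti₀ (neg_pos.2 (Real.log_neg ht0 ht1)) h1.le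

theorem truncLog_of_exp_neg_lt {q N t : ℝ} (ht1 : t < 1) (ht : Real.exp (-N) < t) :
    truncLog q N t = logFun 1 t ^ (-q) := by
  rw [truncLog, max_eq_left (inv_le_logFun_one ht1 ht)]

theorem logFun_mul_truncLog_mem_Icc {q N t : ℝ} (hq : 0 < q) (hN : 0 < N)
    (ht : t ∈ Ico (0 : ℝ) 1) : logFun q t * truncLog q N t ∈ Icc (0 : ℝ) 1 := by
  have h0 := logFun_one_nonneg ht
  have hm : 0 < max (logFun 1 t) N⁻¹ := lt_max_of_lt_right (inv_pos.2 hN)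
  rw [logFun_eq_rpow ht, truncLog, Real.rpow_neg hm.le, ← div_eq_mul_inv]
  exact ⟨by positivity, div_le_one_of_le₀ (Real.rpow_le_rpow h0 (le_max_left _ _) hq.le)
    (by positivity)⟩

theorem logFun_mul_truncLog_of_exp_neg_lt {q N t : ℝ} (ht1 : t < 1) (hN : 0 < N)
    (ht : Real.exp (-N) < t) : logFun q t * truncLog q N t = 1 := by
  have h0 : 0 < logFun 1 t := (inv_pos.2 hN).trans_le (inv_le_logFun_one ht1 ht)
  rw [truncLog_of_exp_neg_lt ht1 ht, logFun_eq_rpow ⟨((Real.exp_pos _).trans ht).le, ht1⟩,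
    ← Real.rpow_add h0, add_neg_cancel, Real.rpow_zero]

section Truncation

variable {𝕜 X : Type*} [RCLike 𝕜] [NormedAddCommGroup X] [InnerProductSpace 𝕜 X]
  [CompleteSpace X] {A : X →L[𝕜] X}

theorem norm_truncLog_sub_truncLog_le (hA : A.IsPositive) (hA1 : ‖A‖ < 1) {q N M : ℝ}
    (hq : 0 < q) (hN : 1 ≤ N) (hNM : N ≤ M) (x : X) :
    ‖funcCalc (truncLog q M) A x - funcCalc (truncLog q N) A x‖
      ≤ 5 * M ^ q * ‖funcCalc (resFun (Real.exp (-N))) A x‖ := by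
  have hN0 : 0 < N := one_pos.trans_le hN
  have hM0 : 0 < M := hN0.trans_le hNM
  have hsub : Icc 0 ‖A‖ ⊆ Ico 0 1 := Icc_subset_Ico_right hA1
  have hcM := (continuousOn_truncLog (q := q) hM0).mono hsub
  have hcN := (continuousOn_truncLog (q := q) hN0).mono hsub
  rw [← sub_apply, ← funcCalc_sub hA hcM hcN]
  refine norm_funcCalc_apply_le_resFun hA hA1 (Real.exp_pos _)
    (Real.exp_le_exp.2 (neg_le_neg hN)) (hcM.fun_sub hcN) (fun t _ => ?_) (fun t ht h => ?_) x
  · have h1 := truncLog_nonneg (q := q) (t := t) hM0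
    have h2 := truncLog_nonneg (q := q) (t := t) hN0
    have h3 := truncLog_le (t := t) hq hM0
    have h4 := truncLog_le (t := t) hq hN0
    have h5 : N ^ q ≤ M ^ q := Real.rpow_le_rpow hN0.le hNM hq.le
    exact abs_le.2 ⟨by linarith, by linarith⟩
  · have ht1 := (hsub ht).2
    rw [truncLog_of_exp_neg_lt ht1 h,
      truncLog_of_exp_neg_lt ht1 ((Real.exp_le_exp.2 (neg_le_neg hNM)).trans_lt h), sub_self]

theorem norm_sub_logFun_truncLog_le (hA : A.IsPositive) (hA1 : ‖A‖ < 1) {q N : ℝ}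
    (hq : 0 < q) (hN : 1 ≤ N) (x : X) :
    ‖x - funcCalc (logFun q) A (funcCalc (truncLog q N) A x)‖
      ≤ 5 * ‖funcCalc (resFun (Real.exp (-N))) A x‖ := by
  have hN0 : 0 < N := one_pos.trans_le hN
  have hsub : Icc 0 ‖A‖ ⊆ Ico 0 1 := Icc_subset_Ico_right hA1
  have hcN := (continuousOn_truncLog (q := q) hN0).mono hsub
  have hcq := (continuousOn_logFun hq).mono hsub
  have h1 : x - funcCalc (logFun q) A (funcCalc (truncLog q N) A x)
      = funcCalc (fun t => 1 - logFun q t * truncLog q N t) A x := by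
    rw [funcCalc_sub hA continuousOn_const (hcq.fun_mul hcN), funcCalc_one hA,
      funcCalc_mul hA hcq hcN]
    rfl
  rw [h1, ← mul_one (5 : ℝ)]
  refine norm_funcCalc_apply_le_resFun hA hA1 (Real.exp_pos _)
    (Real.exp_le_exp.2 (neg_le_neg hN)) (continuousOn_const.fun_sub (hcq.fun_mul hcN))
    (fun t ht => ?_) (fun t ht h => ?_) x
  · have h2 := logFun_mul_truncLog_mem_Icc hq hN0 (hsub ht)
    exact abs_le.2 ⟨by linarith [h2.2], by linarith [h2.1]⟩
  · rw [logFun_mul_truncLog_of_exp_neg_lt (hsub ht).2 hN0 h, sub_self]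

/-- Decay of the residuals along the levels `α = e^{-2^n}`, where `f_p(α) = 2^{-np}`, gives every
source condition with a smaller exponent. -/
theorem exists_funcCalc_logFun_eq (hA : A.IsPositive) (hA1 : ‖A‖ < 1) {p q : ℝ} (hq : 0 < q)
    (hqp : q < p) {x : X}
    (hx : (fun n : ℕ => funcCalc (resFun (Real.exp (-2 ^ n))) A x)
      =O[Filter.atTop] fun n : ℕ => (2 ^ (-p) : ℝ) ^ n) :
    ∃ w, x = funcCalc (logFun q) A w := by
  have h2 : ∀ n : ℕ, (1 : ℝ) ≤ 2 ^ n := fun n => one_le_pow₀ one_le_two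
  set w : ℕ → X := fun n => funcCalc (truncLog q (2 ^ n)) A x with hw
  have hsum : Summable fun n => dist (w n) (w (n + 1)) := by
    have hO : (fun n => dist (w n) (w (n + 1))) =O[Filter.atTop]
        fun n : ℕ => ((2 : ℝ) ^ (q - p)) ^ n := by
      have h3 : (fun n => dist (w n) (w (n + 1))) =O[Filter.atTop] fun n : ℕ =>
          (2 ^ q : ℝ) ^ n * ‖funcCalc (resFun (Real.exp (-2 ^ n))) A x‖ := by
        refine Asymptotics.IsBigO.of_bound (5 * 2 ^ q) (Filter.Eventually.of_forall fun n => ?_)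
        rw [Real.norm_of_nonneg dist_nonneg, Real.norm_of_nonneg (by positivity), dist_comm,
          dist_eq_norm]
        refine (norm_truncLog_sub_truncLog_le hA hA1 hq (h2 n)
          (pow_le_pow_right₀ one_le_two n.le_succ) x).trans_eq ?_
        rw [← Real.rpow_pow_comm zero_le_two, pow_succ]
        ring
      refine h3.trans (((Asymptotics.isBigO_refl _ _).mul hx.norm_left).congr_right fun n => ?_)
      rw [← mul_pow, ← Real.rpow_add two_pos, sub_eq_add_neg]
    refine summable_of_isBigO_nat (summable_geometric_of_lt_one (by positivity) ?_) hO
    exact Real.rpow_lt_one_of_one_lt_of_neg one_lt_two (sub_neg.2 hqp)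
  obtain ⟨v, hv⟩ := cauchySeq_tendsto_of_complete (cauchySeq_of_summable_dist hsum)
  refine ⟨v, ?_⟩
  have hlim := ((funcCalc (logFun q) A).continuous.tendsto v).comp hv
  have hx0 : Filter.Tendsto (fun n : ℕ => funcCalc (resFun (Real.exp (-2 ^ n))) A x)
      Filter.atTop (nhds 0) :=
    hx.trans_tendsto (tendsto_pow_atTop_nhds_zero_of_lt_one (by positivity)
      (Real.rpow_lt_one_of_one_lt_of_neg one_lt_two (by linarith)))
  have hx1 : Filter.Tendsto (fun n => x - funcCalc (logFun q) A (w n)) Filter.atTop (nhds 0) :=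
    squeeze_zero_norm (fun n => norm_sub_logFun_truncLog_le hA hA1 hq (h2 n) x)
      (by simpa using hx0.norm.const_mul 5)
  exact sub_eq_zero.1 (tendsto_nhds_unique (hlim.const_sub x) hx1)

end Truncation

/-! ### The converse result -/

theorem mainTheorem5 {𝕜 X Y : Type*} [RCLike 𝕜]
    [NormedAddCommGroup X] [InnerProductSpace 𝕜 X] [CompleteSpace X]
    [NormedAddCommGroup Y] [InnerProductSpace 𝕜 Y] [CompleteSpace Y]
    (T : X →L[𝕜] Y) (hT : Function.Injective T) (hnorm : ‖normalOp T‖ < 1)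
    (p : ℝ) (hp : 0 < p) (xdag : X) (y : Y) (hy : y = T xdag)
    (hrate : Asymptotics.IsBigO (nhdsWithin (0 : ℝ) (Set.Ioi 0))
      (fun α : ℝ => xdag - regSol T y α) (logFun p)) :
    ∀ q : ℝ, 0 < q → q < p → ∃ ρ : ℝ, 0 < ρ ∧ xdag ∈ logSourceSet T q ρ := by
  intro q hq hqp
  subst hy
  have hα : Filter.Tendsto (fun n : ℕ => Real.exp (-2 ^ n)) Filter.atTop
      (nhdsWithin (0 : ℝ) (Set.Ioi 0)) := by
    refine tendsto_nhdsWithin_iff.2 ⟨?_, Filter.Eventually.of_forall fun n => Real.exp_pos _⟩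
    exact Real.tendsto_exp_neg_atTop_nhds_zero.comp
      (tendsto_pow_atTop_atTop_of_one_lt (one_lt_two (α := ℝ)))
  obtain ⟨w, hw⟩ := exists_funcCalc_logFun_eq (isPositive_normalOp T) hnorm (x := xdag) hq hqp <| by
    refine (hrate.comp_tendsto hα).congr (fun n => sub_regSol_eq T xdag (Real.exp_pos _))
      fun n => ?_
    simp only [Function.comp_apply, logFun, Real.log_exp, neg_neg]
    exact (Real.rpow_pow_comm zero_le_two _ _).symm
  -- `+ 1` keeps the radius positive if `w = 0`
  exact ⟨‖w‖ + 1, by positivity, w, by linarith, hw⟩
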